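/- Let $\mathbb{C}[x_{ij} : 1\le i,j\le n]_d$ denote the space of complex homogeneous polynomials (forms) of degree $d$ in $n^2$ variables. The symmetric rank $R_s(P)$ of a form $P$ of degree $d$ is the least $r\in\mathbb{N}$ such that $P=\sum_{i=1}^r \ell_i^{\,d}$ for some linear forms $\ell_1,\dots,\ell_r$. The symmetric border rank $\underline{R}_s(P)$ is the least $r\in\mathbb{N}$ such that $P$ lies in the Zariski closure, within the space of forms of degree $d$, of the set $\{T : R_s(T)=r\}$. Let $\det_n$ be the determinant of the $n\times n$ matrix of variables $(x_{ij})$, a form of degree $n$. **Theorem.** Let $n\ge 3$. If $n$ is even, then $$\underline{R}_s(\det\nolimits_n)\ \ge\ \left(1+\frac{4}{(n-1)(n+2)^2}\right)\binom{n}{n/2}^2 .$$ If $n$ is odd, then $$\underline{R}_s(\det\nolimits_n)\ \ge\ \left(1+\frac{8}{(n-1)(n+3)^2}\right)\binom{n}{(n-1)/2}^2 .$$ -/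

import Mathlib

open scoped BigOperators

noncomputable section

namespace DetBorderRank

/-- The set of all `r` such that `P` is a sum of `r` many `d`-th powers of linear forms. -/
def powerSumLengths {σ : Type*} (d : ℕ) (P : MvPolynomial σ ℂ) : Set ℕ :=
  {r | ∃ v : Fin r → MvPolynomial σ ℂ, (∀ i, (v i).IsHomogeneous 1) ∧ P = ∑ i, v i ^ d}

/-- The symmetric (Waring) rank of a form `P ∈ S^d V`, where `V` is the complex vector space of
linear forms in the variables `σ`; the minimum over the empty set is `⊤`. -/
def symmetricRank {σ : Type*} (d : ℕ) (P : MvPolynomial.homogeneousSubmodule σ ℂ d) : ℕ∞ :=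
  ⨅ r ∈ powerSumLengths d (P : MvPolynomial σ ℂ), (r : ℕ∞)

/-- The Zariski closure of a subset `S` of a complex vector space `W`: the common zeros of all
polynomial functions on `W` that vanish on `S`. A polynomial function on `W` is a polynomial
expression in linear functionals on `W`. -/
def zariskiClosure {W : Type*} [AddCommGroup W] [Module ℂ W] (S : Set W) : Set W :=
  {w | ∀ f : MvPolynomial (Module.Dual ℂ W) ℂ,
    (∀ s ∈ S, MvPolynomial.eval (fun φ : Module.Dual ℂ W => φ s) f = 0) →
      MvPolynomial.eval (fun φ : Module.Dual ℂ W => φ w) f = 0}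

/-- The symmetric border rank of a form `P ∈ S^d V`: the least `r` such that `P` lies in the
Zariski closure, inside `S^d V`, of the set of forms of symmetric rank `r`. -/
def symmetricBorderRank {σ : Type*} (d : ℕ) (P : MvPolynomial.homogeneousSubmodule σ ℂ d) : ℕ∞ :=
  ⨅ r ∈ {r : ℕ | P ∈ zariskiClosure {T | symmetricRank d T = (r : ℕ∞)}}, (r : ℕ∞)

/-- The determinant of the generic `n × n` matrix is a form of degree `n`. -/
theorem det_isHomogeneous (n : ℕ) :
    (Matrix.mvPolynomialX (Fin n) (Fin n) ℂ).det.IsHomogeneous n := by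
  rw [Matrix.det_apply']
  refine MvPolynomial.IsHomogeneous.sum _ _ _ fun τ _ => ?_
  have hprod := MvPolynomial.IsHomogeneous.prod Finset.univ
    (fun i => Matrix.mvPolynomialX (Fin n) (Fin n) ℂ (τ i) i) (fun _ => 1)
    (fun i _ => MvPolynomial.isHomogeneous_X ℂ (τ i, i))
  have hsign : (((Equiv.Perm.sign τ : ℤˣ) : ℤ) : MvPolynomial (Fin n × Fin n) ℂ) =
      MvPolynomial.C (((Equiv.Perm.sign τ : ℤˣ) : ℤ) : ℂ) := by simp
  rw [hsign]
  simpa using hprod.C_mul (((Equiv.Perm.sign τ : ℤˣ) : ℤ) : ℂ)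

/-- The `n × n` determinant polynomial `det_n`, as an element of `S^n V` with `dim V = n ^ 2`. -/
def detForm (n : ℕ) : MvPolynomial.homogeneousSubmodule (Fin n × Fin n) ℂ n :=
  ⟨(Matrix.mvPolynomialX (Fin n) (Fin n) ℂ).det,
    (MvPolynomial.mem_homogeneousSubmodule n _).2 (det_isHomogeneous n)⟩

end DetBorderRank

end

noncomputable section

namespace DetBorderRank

open MvPolynomial

/-! Rank bound by a Koszul flattening. Write `n = d + q`. The order-`d` partials of a form `P` along
pairs of complements of `q`-subsets, tensored with a vector of coefficients and antisymmetrized in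
two slots, give a linear map depending linearly on `P`, with domain of dimension `C(n,q)^2 * n^2`.

For `P = ℓ^n` the image consists of tensors `(e ∧ ℓ) ⊗ ℓ^(q-1)`, so the rank is at most `n^2 - 1`
(`finrank_range_koszulFlattening_le`). Bounded rank is a closed condition, so border rank `r` forces
rank at most `r * (n^2 - 1)`.

For `det_n` the partials are, up to sign, the `q`-minors. A kernel element is a symmetric tensor of
order `q + 1` whose slices lie in their span. It is then alternating in rows and in columns, hence
fixed by its values on pairs of `(q+1)`-subsets, and the kernel has dimension at most `C(n,q+1)^2`
(`finrank_ker_koszulFlattening_minorTensor_le`).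

Hence `r ≥ C(n,q)^2 + (C(n,q)^2 - C(n,q+1)^2) / (n^2 - 1)`; the theorem takes `q = ⌈n/2⌉`. -/

/-- A family of linear maps depending linearly on a parameter: the locus where the rank is at most
`k` is Zariski closed. -/
theorem finrank_range_le_of_mem_zariskiClosure {W E F : Type*} [AddCommGroup W] [Module ℂ W]
    [AddCommGroup E] [Module ℂ E] [AddCommGroup F] [Module ℂ F] [FiniteDimensional ℂ E]
    (K : W →ₗ[ℂ] E →ₗ[ℂ] F) (k : ℕ) {S : Set W}
    (hS : ∀ s ∈ S, Module.finrank ℂ (LinearMap.range (K s)) ≤ k) {w : W}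
    (hw : w ∈ zariskiClosure S) : Module.finrank ℂ (LinearMap.range (K w)) ≤ k := by
  by_contra! hlt
  obtain ⟨f, hf⟩ := exists_linearIndependent_of_le_finrank (R := ℂ)
    (M := LinearMap.range (K w)) (n := k + 1) hlt
  choose v hv using fun i => LinearMap.mem_range.1 (f i).2
  have hind : LinearIndependent ℂ fun i => K w (v i) := by
    have := hf.map' (LinearMap.range (K w)).subtype (Submodule.ker_subtype _)
    simpa [Function.comp_def, hv] using this
  -- `L` selects a `(k+1)`-minor: the determinant of `L (K s (v i))` is polynomial in `s`, vanishes
  -- on `S`, and equals 1 at `w`.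
  obtain ⟨L, hL⟩ := LinearMap.exists_leftInverse_of_injective
    (Fintype.linearCombination ℂ fun i => K w (v i))
    (LinearMap.ker_eq_bot.2 (linearIndependent_iff_injective_fintypeLinearCombination.1 hind))
  have hLw (j) : L (K w (v j)) = Pi.single j 1 := by
    have := LinearMap.congr_fun hL (Pi.single j 1)
    simpa [Fintype.linearCombination_apply_single] using this
  let φ : Fin (k + 1) → Fin (k + 1) → Module.Dual ℂ W := fun i j =>
    (LinearMap.proj j ∘ₗ L) ∘ₗ K.flip (v i)
  have hev (s : W) : eval (fun ψ : Module.Dual ℂ W => ψ s)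
      (Matrix.of fun i j => (X (φ i j) : MvPolynomial (Module.Dual ℂ W) ℂ)).det =
      (Matrix.of fun i j => L (K s (v i)) j).det := by
    rw [RingHom.map_det]
    congr 1
    ext i j
    simp [φ]
  have h := hw (Matrix.of fun i j => X (φ i j)).det fun s hs => by
    rw [hev]
    by_contra hdet
    have h1 : LinearIndependent ℂ fun i => L (K s (v i)) :=
      Matrix.linearIndependent_rows_of_det_ne_zero hdet
    have h2 : LinearIndependent ℂ fun i => (⟨K s (v i), v i, rfl⟩ : LinearMap.range (K s)) :=
      LinearIndependent.of_comp (L ∘ₗ (LinearMap.range (K s)).subtype) h1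
    have := h2.fintype_card_le_finrank
    have := hS s hs
    simp at *
    omega
  rw [hev] at h
  have : (Matrix.of fun i j => L (K w (v i)) j) = (1 : Matrix (Fin (k + 1)) (Fin (k + 1)) ℂ) := by
    ext i j
    simp [hLw, Matrix.one_apply, Pi.single_apply, eq_comm]
  simp [this] at h

/-- A form of finite symmetric rank `r` is a sum of `r` powers of linear forms. -/
theorem mem_powerSumLengths_of_symmetricRank_eq {σ : Type*} {d r : ℕ}
    {T : homogeneousSubmodule σ ℂ d} (h : symmetricRank d T = r) :
    r ∈ powerSumLengths d (T : MvPolynomial σ ℂ) := by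
  rcases (powerSumLengths d (T : MvPolynomial σ ℂ)).eq_empty_or_nonempty with h0 | h0
  · simp [symmetricRank, h0] at h
  · have : symmetricRank d T = (sInf (powerSumLengths d (T : MvPolynomial σ ℂ)) : ℕ) := by
      rw [ENat.natCast_sInf h0, symmetricRank]
    have hr : r = sInf (powerSumLengths d (T : MvPolynomial σ ℂ)) := by
      exact_mod_cast h.symm.trans this
    exact hr ▸ Nat.sInf_mem h0

/-! ### Polarization of powers and of the determinant. -/

section Polarization

variable {σ : Type*} [DecidableEq σ] {n : ℕ}

/-- The polarization of a form at the coordinate vectors `b 0, …, b (n - 1)`: the coefficient of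
`y₀ ⋯ yₙ₋₁` in the value of the form at `∑ yₖ e_{b k}`. -/
def polarization (b : Fin n → σ) : MvPolynomial σ ℂ →ₗ[ℂ] ℂ :=
  lcoeff ℂ (∑ k, Finsupp.single k 1) ∘ₗ
    (aeval fun a : σ => ∑ k, if b k = a then (X k : MvPolynomial (Fin n) ℂ) else 0).toLinearMap

theorem polarization_pow (b : Fin n → σ) {ℓ : MvPolynomial σ ℂ} (hℓ : ℓ.IsHomogeneous 1) :
    polarization b (ℓ ^ n) = n.factorial * ∏ k, ℓ.coeff (Finsupp.single (b k) 1) := by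
  have key : (aeval fun a : σ => ∑ k, if b k = a then (X k : MvPolynomial (Fin n) ℂ) else 0) ℓ =
      ∑ k, C (ℓ.coeff (Finsupp.single (b k) 1)) * X k := by
    have hmem : ℓ ∈ Submodule.span ℂ (Set.range (X : σ → MvPolynomial σ ℂ)) := by
      rw [← homogeneousSubmodule_one_eq_span_X]; exact hℓ
    induction hmem using Submodule.span_induction with
    | mem x hx =>
      obtain ⟨a, rfl⟩ := hx
      rw [aeval_X]
      refine Finset.sum_congr rfl fun k _ => ?_
      by_cases h : b k = a <;> simp [h, coeff_X, Finsupp.single_left_inj, eq_comm (a := a)]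
    | zero => simp
    | add x y hx hy h1 h2 =>
      have e (z) (hz : z ∈ Submodule.span ℂ (Set.range (X : σ → MvPolynomial σ ℂ))) :
          z.IsHomogeneous 1 := by
        rw [← homogeneousSubmodule_one_eq_span_X] at hz; exact hz
      rw [map_add, h1 (e x hx), h2 (e y hy), ← Finset.sum_add_distrib]
      simp [add_mul]
    | smul c x hx h1 =>
      have e : x.IsHomogeneous 1 := by
        rw [← homogeneousSubmodule_one_eq_span_X] at hx; exact hx
      rw [map_smul, h1 e, Finset.smul_sum]
      simp [smul_eq_C_mul, mul_assoc]
  have hmon (k : Fin n → ℕ) : ∏ i, (C (ℓ.coeff (Finsupp.single (b i) 1)) * X i) ^ k i =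
      monomial (Finsupp.equivFunOnFinite.symm k)
        (∏ i, ℓ.coeff (Finsupp.single (b i) 1) ^ k i) := by
    rw [monomial_eq, Finsupp.prod_fintype _ _ (by simp)]
    simp [mul_pow, Finset.prod_mul_distrib]
  have hone : (∑ k : Fin n, Finsupp.single k 1) =
      Finsupp.equivFunOnFinite.symm (fun _ : Fin n => (1 : ℕ)) := by
    ext i; simp [Finsupp.finsetSum_apply, Finsupp.single_apply]
  simp only [polarization, LinearMap.comp_apply, AlgHom.toLinearMap_apply, map_pow, key,
    lcoeff_apply, Finset.sum_pow_eq_sum_piAntidiag, hmon, hone]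
  rw [coeff_sum, Finset.sum_eq_single (fun _ => 1)]
  · rw [← map_natCast (C : ℂ →+* MvPolynomial (Fin n) ℂ), coeff_C_mul, coeff_monomial]
    simp [Nat.multinomial]
  · intro k _ hk
    rw [← map_natCast (C : ℂ →+* MvPolynomial (Fin n) ℂ), coeff_C_mul, coeff_monomial, if_neg,
      mul_zero]
    exact fun h => hk (Finsupp.equivFunOnFinite.symm.injective h)
  · intro h
    simp [Finset.mem_piAntidiag] at h

/-- The sign of a map `Fin n → Fin n`: zero unless it is a permutation. -/
def mapSign (s : Fin n → Fin n) : ℂ := ((1 : Matrix (Fin n) (Fin n) ℂ).submatrix s id).det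

theorem mapSign_comp (s : Fin n → Fin n) (τ : Equiv.Perm (Fin n)) :
    mapSign (s ∘ τ) = (Equiv.Perm.sign τ : ℤ) * mapSign s := by
  simpa [mapSign, Matrix.submatrix_submatrix] using
    Matrix.det_permute τ ((1 : Matrix (Fin n) (Fin n) ℂ).submatrix s id)

theorem mapSign_eq_zero {s : Fin n → Fin n} (hs : ¬ Function.Injective s) : mapSign s = 0 := by
  simp only [Function.Injective, not_forall] at hs
  obtain ⟨i, j, h, hij⟩ := hs
  exact Matrix.det_zero_of_row_eq hij (funext fun a => by
    rw [Matrix.submatrix_apply, Matrix.submatrix_apply, h])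

theorem mapSign_ne_zero {s : Fin n → Fin n} (hs : Function.Injective s) : mapSign s ≠ 0 := by
  have h1 : mapSign (id : Fin n → Fin n) = 1 := by simp [mapSign]
  have h := mapSign_comp id (Equiv.ofBijective s (Finite.injective_iff_bijective.1 hs))
  rw [h1] at h
  change mapSign s = _ at h
  rw [h]
  simp

/-- The substitution turns the generic matrix into `∑ yₖ E_{s k, t k} = P(s)ᵀ diag(y) P(t)`, whose
determinant factors. -/
theorem polarization_det (s t : Fin n → Fin n) :
    polarization (fun k => (s k, t k)) (Matrix.mvPolynomialX (Fin n) (Fin n) ℂ).det =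
      mapSign s * mapSign t := by
  let P (s : Fin n → Fin n) : Matrix (Fin n) (Fin n) (MvPolynomial (Fin n) ℂ) :=
    C.mapMatrix ((1 : Matrix (Fin n) (Fin n) ℂ).submatrix s id)
  have hM : (aeval fun a : Fin n × Fin n =>
      ∑ k, if (s k, t k) = a then (X k : MvPolynomial (Fin n) ℂ) else 0).mapMatrix
        (Matrix.mvPolynomialX (Fin n) (Fin n) ℂ) =
      (P s).transpose * Matrix.diagonal X * P t := by
    ext1 i j
    simp only [AlgHom.mapMatrix_apply, Matrix.map_apply, Matrix.mvPolynomialX_apply, aeval_X]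
    rw [Matrix.mul_apply]
    simp only [Matrix.mul_diagonal]
    refine Finset.sum_congr rfl fun k _ => ?_
    by_cases h1 : s k = i <;> by_cases h2 : t k = j <;> simp [P, h1, h2, Matrix.one_apply]
  simp only [polarization, LinearMap.comp_apply, AlgHom.toLinearMap_apply, AlgHom.map_det, hM]
  have hX : (∏ k, X k : MvPolynomial (Fin n) ℂ) = monomial (∑ k, Finsupp.single k 1) 1 := by
    rw [monomial_sum_one]; rfl
  have hP (s : Fin n → Fin n) : (P s).det = C (mapSign s) := (RingHom.map_det _ _).symm
  rw [Matrix.det_mul, Matrix.det_mul, Matrix.det_transpose, Matrix.det_diagonal, hP, hP, hX,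
    mul_comm, ← mul_assoc, ← C_mul, lcoeff_apply, coeff_C_mul, coeff_monomial]
  simp [mul_comm]

end Polarization

/-! ### Koszul flattenings. -/

section Koszul

variable {I σ : Type*} [Fintype I] {p : ℕ}

/-- The contraction of a family of tensors `φ m` against coefficients `c (m, a)`, giving a tensor
with one more slot. -/
def contraction : (I → (Fin p → σ) → ℂ) →ₗ[ℂ] (I × σ → ℂ) →ₗ[ℂ] ((Fin (p + 1) → σ) → ℂ) :=
  LinearMap.mk₂ ℂ (fun φ c x => ∑ m, c (m, x 0) * φ m (Fin.tail x))
    (fun _ _ _ => by ext; simp [mul_add, Finset.sum_add_distrib])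
    (fun _ _ _ => by ext; simp [Finset.mul_sum, mul_left_comm])
    (fun _ _ _ => by ext; simp [add_mul, Finset.sum_add_distrib])
    (fun _ _ _ => by ext; simp [Finset.mul_sum, mul_assoc])

theorem contraction_apply (φ : I → (Fin p → σ) → ℂ) (c : I × σ → ℂ) (x : Fin (p + 1) → σ) :
    contraction φ c x = ∑ m, c (m, x 0) * φ m (Fin.tail x) := rfl

/-- Antisymmetrization of a tensor in its first two slots. -/
def antisymm : ((Fin (p + 2) → σ) → ℂ) →ₗ[ℂ] (σ × σ × (Fin p → σ) → ℂ) where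
  toFun G x := G (Fin.cons x.1 (Fin.cons x.2.1 x.2.2)) - G (Fin.cons x.2.1 (Fin.cons x.1 x.2.2))
  map_add' _ _ := by ext; simp; ring
  map_smul' _ _ := by ext; simp; ring

/-- The Koszul flattening of a family of tensors. -/
def koszulFlattening :
    (I → (Fin (p + 1) → σ) → ℂ) →ₗ[ℂ] (I × σ → ℂ) →ₗ[ℂ] (σ × σ × (Fin p → σ) → ℂ) :=
  contraction.compr₂ antisymm

/-- The flattening factors through `e ↦ e ∧ ℓ`, which kills `ℓ`. This accounts for the `- 1`, the
source of the gain over the plain flattening bound `C(n,q)^2`. -/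
theorem finrank_range_koszulFlattening_le [Fintype σ] (α : I → ℂ) (ℓ : σ → ℂ) :
    Module.finrank ℂ (LinearMap.range
      (koszulFlattening fun m (x : Fin (p + 1) → σ) => α m * ∏ k, ℓ (x k))) ≤
      Fintype.card σ - 1 := by
  let A : (I × σ → ℂ) →ₗ[ℂ] (σ → ℂ) :=
    { toFun := fun c b => ∑ m, c (m, b) * α m
      map_add' := fun _ _ => by ext; simp [add_mul, Finset.sum_add_distrib]
      map_smul' := fun _ _ => by ext; simp [Finset.mul_sum, mul_assoc] }
  let B : (σ → ℂ) →ₗ[ℂ] (σ × σ × (Fin p → σ) → ℂ) :=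
    { toFun := fun e x => (e x.1 * ℓ x.2.1 - e x.2.1 * ℓ x.1) * ∏ k, ℓ (x.2.2 k)
      map_add' := fun _ _ => by ext; simp; ring
      map_smul' := fun _ _ => by ext; simp; ring }
  have hAB : (koszulFlattening fun m (x : Fin (p + 1) → σ) => α m * ∏ k, ℓ (x k)) = B ∘ₗ A := by
    refine LinearMap.ext fun c => funext fun x => ?_
    simp only [koszulFlattening, LinearMap.compr₂_apply, antisymm, LinearMap.coe_mk,
      AddHom.coe_mk, contraction_apply, LinearMap.comp_apply, A, B, Fin.tail_cons, Fin.cons_zero,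
      Fin.prod_univ_succ, Fin.cons_succ, Finset.sum_mul, ← Finset.sum_sub_distrib]
    refine Finset.sum_congr rfl fun m _ => ?_
    ring
  have h1 : Module.finrank ℂ (LinearMap.range (B ∘ₗ A)) ≤ Module.finrank ℂ (LinearMap.range B) :=
    Submodule.finrank_mono (LinearMap.range_comp_le_range A B)
  rw [hAB]
  refine h1.trans ?_
  by_cases hℓ : ℓ = 0
  · have : B = 0 := by
      refine LinearMap.ext fun c => funext fun x => ?_
      simp [B, hℓ]
    rw [this, LinearMap.range_zero, finrank_bot]
    exact Nat.zero_le _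
  · have hker : ℓ ∈ LinearMap.ker B := by
      rw [LinearMap.mem_ker]
      ext x
      simp [B, mul_comm]
    have hpos : 0 < Module.finrank ℂ (LinearMap.ker B) :=
      Module.finrank_pos_iff_exists_ne_zero.2 ⟨⟨ℓ, hker⟩, by simpa using hℓ⟩
    have := LinearMap.finrank_range_add_finrank_ker B
    rw [Module.finrank_fintype_fun_eq_card] at this
    omega

theorem contraction_swap_of_koszulFlattening_eq_zero {φ : I → (Fin (p + 1) → σ) → ℂ}
    {c : I × σ → ℂ} (hc : koszulFlattening φ c = 0) (x : Fin (p + 2) → σ) :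
    contraction φ c (x ∘ Equiv.swap 0 1) = contraction φ c x := by
  have h := congrFun hc (x 1, x 0, Fin.tail (Fin.tail x))
  simp only [koszulFlattening, LinearMap.compr₂_apply, antisymm, LinearMap.coe_mk,
    AddHom.coe_mk, Pi.zero_apply, sub_eq_zero] at h
  convert h using 2
  · ext i
    refine Fin.cases ?_ (fun i => Fin.cases ?_ (fun i => ?_) i) i
    · simp
    · simp
    · simp only [Function.comp_apply, Fin.cons_succ]
      rw [Equiv.swap_apply_of_ne_of_ne] <;> simp [Fin.tail, Fin.ext_iff]
  · ext i
    refine Fin.cases ?_ (fun i => Fin.cases ?_ (fun i => ?_) i) i <;> simp [Fin.tail]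

/-- If the tensors `φ m` are symmetric, a contraction killed by the Koszul flattening is symmetric
in all its slots. -/
theorem contraction_comp_perm {φ : I → (Fin (p + 1) → σ) → ℂ}
    (hφ : ∀ m x (τ : Equiv.Perm (Fin (p + 1))), φ m (x ∘ τ) = φ m x)
    {c : I × σ → ℂ} (hc : koszulFlattening φ c = 0) (τ : Equiv.Perm (Fin (p + 2))) :
    ∀ x : Fin (p + 2) → σ, contraction φ c (x ∘ τ) = contraction φ c x := by
  have hτ : τ ∈ Submonoid.closure
      (Set.range fun i : Fin (p + 1) => Equiv.swap i.castSucc i.succ) := by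
    rw [Equiv.Perm.mclosure_swap_castSucc_succ]; trivial
  induction hτ using Submonoid.closure_induction with
  | mem τ hτ =>
    obtain ⟨i, rfl⟩ := hτ
    intro x
    -- The transposition of slots 0 and 1 is the kernel condition; the others act inside the
    -- symmetric `φ m`.
    refine Fin.cases ?_ (fun j => ?_) i
    · exact contraction_swap_of_koszulFlattening_eq_zero hc x
    · rw [contraction_apply, contraction_apply]
      refine Finset.sum_congr rfl fun m _ => ?_
      have h0 : (x ∘ Equiv.swap j.succ.castSucc j.succ.succ) 0 = x 0 := by
        rw [Function.comp_apply, Equiv.swap_apply_of_ne_of_ne] <;> simp [Fin.ext_iff]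
      have h1 : Fin.tail (x ∘ Equiv.swap j.succ.castSucc j.succ.succ) =
          Fin.tail x ∘ Equiv.swap j.castSucc j.succ := by
        ext i
        simp only [Fin.tail, Function.comp_apply, ← Fin.succ_castSucc]
        congr 1
        exact ((Fin.succ_injective _).swap_apply _ _ _)
      rw [h0, h1, hφ]
  | one => intro x; rfl
  | mul a b _ _ ha hb =>
    intro x
    rw [Equiv.Perm.coe_mul, ← Function.comp_assoc, hb, ha]

end Koszul

/-! ### Alternating functions of words and signs of concatenated words. -/

/-- A function of two words that is invariant under simultaneous permutation and alternating in the
second word vanishes as soon as it vanishes on pairs of strictly increasing words. -/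
theorem eq_zero_of_forall_orderEmbOfFin {n k : ℕ} {G : (Fin k → Fin n) → (Fin k → Fin n) → ℂ}
    (hsymm : ∀ (τ : Equiv.Perm (Fin k)) s t, G (s ∘ τ) (t ∘ τ) = G s t)
    (halt : ∀ i j, i ≠ j → ∀ s t, G s (t ∘ Equiv.swap i j) = -G s t)
    (h0 : ∀ S T : {S : Finset (Fin n) // S.card = k},
      G (S.1.orderEmbOfFin S.2) (T.1.orderEmbOfFin T.2) = 0) (s t : Fin k → Fin n) :
    G s t = 0 := by
  have hright (τ : Equiv.Perm (Fin k)) : ∀ s t, G s (t ∘ τ) = 0 → G s t = 0 := by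
    induction τ using Equiv.Perm.swap_induction_on' with
    | one => exact fun s t h => h
    | mul_swap f i j hij ih =>
      intro s t h
      rw [Equiv.Perm.coe_mul, ← Function.comp_assoc, halt i j hij, neg_eq_zero] at h
      exact ih s t h
  -- By simultaneous invariance, permuting `s` by `τ` amounts to permuting `t` by `τ⁻¹`.
  have hleft (τ : Equiv.Perm (Fin k)) (s t) (h : G (s ∘ τ) t = 0) : G s t = 0 := by
    refine hright τ⁻¹ s t ?_
    rw [← hsymm τ, Function.comp_assoc, ← Equiv.Perm.coe_mul]
    simpa using h
  have hself (i j) (hij : i ≠ j) (s t) (h : t ∘ Equiv.swap i j = t) : G s t = 0 := by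
    have := halt i j hij s t
    rw [h] at this
    exact self_eq_neg.1 this
  have hcomp (f : Fin k → Fin n) (i j) (h : f i = f j) : f ∘ Equiv.swap i j = f := by
    ext a
    rw [Function.comp_apply, Equiv.swap_apply_def]
    split_ifs with h1 h2 <;> simp_all
  by_cases ht : Function.Injective t
  swap
  · simp only [Function.Injective, not_forall] at ht
    obtain ⟨i, j, h, hij⟩ := ht
    exact hself i j hij s t (hcomp t i j h)
  by_cases hs : Function.Injective s
  swap
  · simp only [Function.Injective, not_forall] at hs
    obtain ⟨i, j, h, hij⟩ := hs
    have h1 := hsymm (Equiv.swap i j) s t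
    rw [hcomp s i j h, halt i j hij] at h1
    exact self_eq_neg.1 h1.symm
  have hsort (f : Fin k → Fin n) (hf : Function.Injective f) :
      ∃ S : {S : Finset (Fin n) // S.card = k}, f ∘ Tuple.sort f = S.1.orderEmbOfFin S.2 := by
    have hmono : StrictMono (f ∘ Tuple.sort f) :=
      (Tuple.monotone_sort f).strictMono_of_injective (hf.comp (Tuple.sort f).injective)
    refine ⟨⟨Finset.univ.image f, by simp [Finset.card_image_of_injective _ hf]⟩, ?_⟩
    exact Finset.orderEmbOfFin_unique _ (fun x => by simp) hmono
  obtain ⟨S, hS⟩ := hsort s hs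
  obtain ⟨T, hT⟩ := hsort t ht
  refine hleft (Tuple.sort s) s t (hright (Tuple.sort t) _ t ?_)
  rw [hS, hT]
  exact h0 S T

theorem mapSign_append_comp {d q : ℕ} (u : Fin d → Fin (d + q)) (s : Fin q → Fin (d + q))
    (τ : Equiv.Perm (Fin q)) :
    mapSign (Fin.append u (s ∘ τ)) = (Equiv.Perm.sign τ : ℤ) * mapSign (Fin.append u s) := by
  have h : Fin.append u (s ∘ τ) =
      Fin.append u s ∘ finSumFinEquiv.permCongr (Equiv.Perm.sumCongr 1 τ) := by
    ext i
    refine Fin.addCases (fun i => ?_) (fun i => ?_) i <;> simp [Equiv.permCongr_apply]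
  rw [h, mapSign_comp]
  simp

theorem mapSign_append_orderEmbOfFin_ne_zero_iff {d q : ℕ} {S T : Finset (Fin (d + q))}
    (hS : Sᶜ.card = d) (hT : T.card = q) :
    mapSign (Fin.append (Sᶜ.orderEmbOfFin hS) (T.orderEmbOfFin hT)) ≠ 0 ↔ S = T := by
  have hinj : Function.Injective (Fin.append (Sᶜ.orderEmbOfFin hS) (T.orderEmbOfFin hT)) ↔
      S = T := by
    have hSq : S.card = q := by
      have := Finset.card_compl_add_card S; rw [Fintype.card_fin] at this; omega
    rw [Fin.append_injective_iff]
    constructor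
    · rintro ⟨-, -, h⟩
      refine (Finset.eq_of_subset_of_card_le (fun x hx => ?_) (by omega)).symm
      by_contra hxS
      have h1 : x ∈ Set.range (Sᶜ.orderEmbOfFin hS) := by simpa using hxS
      have h2 : x ∈ Set.range (T.orderEmbOfFin hT) := by simpa using hx
      obtain ⟨i, hi⟩ := h1
      obtain ⟨j, hj⟩ := h2
      exact h i j (hi.trans hj.symm)
    · rintro rfl
      refine ⟨RelEmbedding.injective _, RelEmbedding.injective _, fun i j h => ?_⟩
      have h1 := Finset.orderEmbOfFin_mem Sᶜ hS i
      rw [h] at h1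
      exact (Finset.mem_compl.1 h1) (Finset.orderEmbOfFin_mem S hT j)
  rw [← hinj]
  exact ⟨fun h => by_contra fun h' => h (mapSign_eq_zero h'), mapSign_ne_zero⟩

/-! ### Partial derivatives of the determinant as minors. -/

section DetTensor

variable {d q : ℕ}

/-- The `k`-element subsets of `Fin n`. -/
abbrev SubsetsOfCard (n k : ℕ) : Type := {S : Finset (Fin n) // S.card = k}

theorem SubsetsOfCard.card_compl (S : SubsetsOfCard (d + q) q) : S.1ᶜ.card = d := by
  rw [Finset.card_compl, Fintype.card_fin, S.2, Nat.add_sub_cancel]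

/-- The increasing enumeration of the complement of a `q`-element subset. -/
def complWord (S : SubsetsOfCard (d + q) q) : Fin d → Fin (d + q) :=
  S.1ᶜ.orderEmbOfFin S.card_compl

/-- The tensors of the minors of the generic matrix; the minor with rows `m.1` and columns `m.2` is
indexed by `m`. -/
def minorTensor (m : SubsetsOfCard (d + q) q × SubsetsOfCard (d + q) q)
    (x : Fin q → Fin (d + q) × Fin (d + q)) : ℂ :=
  mapSign (Fin.append (complWord m.1) fun k => (x k).1) *
    mapSign (Fin.append (complWord m.2) fun k => (x k).2)

theorem minorTensor_comp_perm (m : SubsetsOfCard (d + q) q × SubsetsOfCard (d + q) q)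
    (x : Fin q → Fin (d + q) × Fin (d + q)) (τ : Equiv.Perm (Fin q)) :
    minorTensor m (x ∘ τ) = minorTensor m x := by
  have h1 := mapSign_append_comp (complWord m.1) (fun k => (x k).1) τ
  have h2 := mapSign_append_comp (complWord m.2) (fun k => (x k).2) τ
  have h3 : (((Equiv.Perm.sign τ : ℤˣ) : ℤ) : ℂ) * ((Equiv.Perm.sign τ : ℤˣ) : ℤ) = 1 := by
    rcases Int.units_eq_one_or (Equiv.Perm.sign τ) with h | h <;> simp [h]
  calc minorTensor m (x ∘ τ) = _ := congrArg₂ (· * ·) h1 h2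
    _ = ((((Equiv.Perm.sign τ : ℤˣ) : ℤ) : ℂ) * ((Equiv.Perm.sign τ : ℤˣ) : ℤ)) *
        minorTensor m x := by simp only [minorTensor]; ring
    _ = minorTensor m x := by rw [h3, one_mul]

theorem minorTensor_swap (m : SubsetsOfCard (d + q) q × SubsetsOfCard (d + q) q)
    (s t : Fin q → Fin (d + q)) {i j : Fin q} (hij : i ≠ j) :
    minorTensor m (fun k => (s k, t (Equiv.swap i j k))) =
      -minorTensor m fun k => (s k, t k) := by
  have h := mapSign_append_comp (complWord m.2) t (Equiv.swap i j)
  simp only [Equiv.Perm.sign_swap hij] at h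
  simp only [minorTensor]
  change _ * mapSign (Fin.append (complWord m.2) (t ∘ Equiv.swap i j)) = _
  rw [h]
  simp

theorem minorTensor_orderEmbOfFin_ne_zero_iff
    (m m' : SubsetsOfCard (d + q) q × SubsetsOfCard (d + q) q) :
    minorTensor m (fun k => (m'.1.1.orderEmbOfFin m'.1.2 k, m'.2.1.orderEmbOfFin m'.2.2 k)) ≠ 0 ↔
      m = m' := by
  rw [minorTensor, mul_ne_zero_iff]
  refine (and_congr (mapSign_append_orderEmbOfFin_ne_zero_iff _ m'.1.2)
    (mapSign_append_orderEmbOfFin_ne_zero_iff _ m'.2.2)).trans ?_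
  rw [Prod.ext_iff, Subtype.ext_iff, Subtype.ext_iff]

/-- The minors are linearly independent: on the increasing words of `m`, only the minor `m`
survives. -/
theorem eq_zero_of_contraction_minorTensor_eq_zero
    {c : (SubsetsOfCard (d + q) q × SubsetsOfCard (d + q) q) × (Fin (d + q) × Fin (d + q)) → ℂ}
    (hc : ∀ x, contraction minorTensor c x = 0) : c = 0 := by
  ext ⟨m, b⟩
  have h := hc (Fin.cons b fun k => (m.1.1.orderEmbOfFin m.1.2 k, m.2.1.orderEmbOfFin m.2.2 k))
  rw [contraction_apply, Finset.sum_eq_single m] at h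
  · simp only [Fin.cons_zero, Fin.tail_cons, mul_eq_zero] at h
    exact h.resolve_right ((minorTensor_orderEmbOfFin_ne_zero_iff m m).2 rfl)
  · intro m' _ hm
    rw [Fin.tail_cons, not_not.1 (mt (minorTensor_orderEmbOfFin_ne_zero_iff m' m).1 hm), mul_zero]
  · simp

/-- The family of tensors of partial derivatives of order `d` of a form of degree `d + q`, along the
increasing words in complements of pairs of `q`-element subsets. -/
def partialTensor (d q : ℕ) : homogeneousSubmodule (Fin (d + q) × Fin (d + q)) ℂ (d + q) →ₗ[ℂ]
    (SubsetsOfCard (d + q) q × SubsetsOfCard (d + q) q →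
      (Fin q → Fin (d + q) × Fin (d + q)) → ℂ) :=
  LinearMap.pi fun m => LinearMap.pi fun x =>
    polarization (Fin.append (fun k => (complWord m.1 k, complWord m.2 k)) x) ∘ₗ
      Submodule.subtype _

theorem partialTensor_detForm : partialTensor d q (detForm (d + q)) = minorTensor := by
  ext m x
  have h : Fin.append (fun k => (complWord m.1 k, complWord m.2 k)) x =
      fun k => (Fin.append (complWord m.1) (fun k => (x k).1) k,
        Fin.append (complWord m.2) (fun k => (x k).2) k) := by
    ext1 i
    refine Fin.addCases (fun i => ?_) (fun i => ?_) i <;> simp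
  exact (congrArg (fun b => polarization b _) h).trans (polarization_det _ _)

theorem partialTensor_eq_sum {r : ℕ}
    {T : homogeneousSubmodule (Fin (d + q) × Fin (d + q)) ℂ (d + q)}
    {v : Fin r → MvPolynomial (Fin (d + q) × Fin (d + q)) ℂ}
    (hv : ∀ i, (v i).IsHomogeneous 1) (hT : (T : MvPolynomial _ ℂ) = ∑ i, v i ^ (d + q)) :
    partialTensor d q T = ∑ i, fun m x =>
      ((d + q).factorial * ∏ k, (v i).coeff (Finsupp.single (complWord m.1 k, complWord m.2 k) 1)) *
        ∏ k, (v i).coeff (Finsupp.single (x k) 1) := by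
  ext m x
  simp only [partialTensor, LinearMap.pi_apply, LinearMap.comp_apply, Submodule.subtype_apply, hT,
    map_sum, polarization_pow _ (hv _), Fin.prod_univ_add, Fin.append_left, Fin.append_right,
    Finset.sum_apply, mul_assoc]

end DetTensor

/-! ### Kernel of the determinant's flattening and the rank count. -/

variable {d p : ℕ}

theorem contraction_minorTensor_swap
    {c : (SubsetsOfCard (d + (p + 2)) (p + 2) × SubsetsOfCard (d + (p + 2)) (p + 2)) ×
      (Fin (d + (p + 2)) × Fin (d + (p + 2))) → ℂ}
    (hc : koszulFlattening minorTensor c = 0) {i j : Fin (p + 3)} (hij : i ≠ j)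
    (s t : Fin (p + 3) → Fin (d + (p + 2))) :
    contraction minorTensor c (fun k => (s k, t (Equiv.swap i j k))) =
      -contraction minorTensor c fun k => (s k, t k) := by
  have hsucc (a b : Fin (p + 2)) (hab : a ≠ b) (s t : Fin (p + 3) → Fin (d + (p + 2))) :
      contraction minorTensor c (fun k => (s k, t (Equiv.swap a.succ b.succ k))) =
        -contraction minorTensor c fun k => (s k, t k) := by
    rw [contraction_apply, contraction_apply, ← Finset.sum_neg_distrib]
    refine Finset.sum_congr rfl fun m _ => ?_
    have h := minorTensor_swap m (fun k => s k.succ) (fun k => t k.succ) hab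
    rw [← mul_neg, Equiv.swap_apply_of_ne_of_ne (Fin.succ_ne_zero a).symm
      (Fin.succ_ne_zero b).symm]
    congr 1
    refine Eq.trans ?_ h
    congr 1
    ext1 k
    simp only [Fin.tail, (Fin.succ_injective _).swap_apply]
  -- Minors alternate only in slots other than 0. A third slot `l` is moved into slot 0 by full
  -- symmetry; this needs `q + 1 ≥ 3`, hence `q = p + 2`.
  obtain ⟨l, hli, hlj⟩ := Fin.exists_ne_and_ne_of_two_lt i j (by omega)
  have hne (a : Fin (p + 3)) (ha : l ≠ a) : Equiv.swap 0 l a ≠ 0 := fun h =>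
    ha ((Equiv.swap 0 l).injective (by rw [h, Equiv.swap_apply_right]))
  obtain ⟨a, ha⟩ := Fin.exists_succ_eq.2 (hne i hli)
  obtain ⟨b, hb⟩ := Fin.exists_succ_eq.2 (hne j hlj)
  have hab : a ≠ b := by
    rintro rfl
    exact hij ((Equiv.swap 0 l).injective (ha.symm.trans hb))
  have hperm := contraction_comp_perm minorTensor_comp_perm hc (Equiv.swap 0 l)
  rw [← hperm, ← hperm fun k => (s k, t k)]
  refine Eq.trans ?_ (hsucc a b hab (s ∘ Equiv.swap 0 l) (t ∘ Equiv.swap 0 l))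
  refine congrArg (contraction minorTensor c) (funext fun k => ?_)
  have h := (Equiv.swap 0 l).injective.swap_apply (Equiv.swap 0 l i) (Equiv.swap 0 l j) k
  rw [Equiv.swap_apply_self, Equiv.swap_apply_self] at h
  simp only [Function.comp_apply, ha, hb, h]

theorem finrank_ker_koszulFlattening_minorTensor_le :
    Module.finrank ℂ (LinearMap.ker (koszulFlattening (p := p + 1) (minorTensor (d := d)))) ≤
      (d + (p + 2)).choose (p + 3) ^ 2 := by
  let Φ : ((SubsetsOfCard (d + (p + 2)) (p + 2) × SubsetsOfCard (d + (p + 2)) (p + 2)) ×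
      (Fin (d + (p + 2)) × Fin (d + (p + 2))) → ℂ) →ₗ[ℂ]
      (SubsetsOfCard (d + (p + 2)) (p + 3) × SubsetsOfCard (d + (p + 2)) (p + 3) → ℂ) :=
    LinearMap.funLeft ℂ ℂ (fun m k => (m.1.1.orderEmbOfFin m.1.2 k, m.2.1.orderEmbOfFin m.2.2 k)) ∘ₗ
      contraction minorTensor
  have hinj : Function.Injective
      (Φ.domRestrict (LinearMap.ker (koszulFlattening (p := p + 1) (minorTensor (d := d))))) := by
    rw [← LinearMap.ker_eq_bot, LinearMap.ker_eq_bot']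
    rintro ⟨c, hc⟩ h
    rw [LinearMap.mem_ker] at hc
    refine Subtype.ext (eq_zero_of_contraction_minorTensor_eq_zero fun x => ?_)
    exact eq_zero_of_forall_orderEmbOfFin
      (G := fun s t => contraction minorTensor c fun k => (s k, t k))
      (fun τ s t => contraction_comp_perm minorTensor_comp_perm hc τ fun k => (s k, t k))
      (fun i j hij s t => contraction_minorTensor_swap hc hij s t)
      (fun S T => congrFun h (S, T)) (fun k => (x k).1) (fun k => (x k).2)
  refine (LinearMap.finrank_le_finrank_of_injective hinj).trans_eq ?_
  rw [Module.finrank_fintype_fun_eq_card, Fintype.card_prod, Fintype.card_finset_len,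
    Fintype.card_fin, sq]

theorem le_finrank_range_koszulFlattening_minorTensor :
    (d + (p + 2)).choose (p + 2) ^ 2 * (d + (p + 2)) ^ 2 ≤
      Module.finrank ℂ (LinearMap.range (koszulFlattening (p := p + 1) (minorTensor (d := d)))) +
        (d + (p + 2)).choose (p + 3) ^ 2 := by
  have h := LinearMap.finrank_range_add_finrank_ker
    (koszulFlattening (p := p + 1) (minorTensor (d := d)))
  rw [Module.finrank_fintype_fun_eq_card, Fintype.card_prod, Fintype.card_prod, Fintype.card_prod,
    Fintype.card_finset_len, Fintype.card_fin] at h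
  have := finrank_ker_koszulFlattening_minorTensor_le (d := d) (p := p)
  rw [sq, sq (d + (p + 2)), ← h]
  omega

theorem finrank_range_sum_le {ι E F : Type*} [AddCommGroup E] [Module ℂ E] [AddCommGroup F]
    [Module ℂ F] [FiniteDimensional ℂ F] (s : Finset ι) (f : ι → E →ₗ[ℂ] F) {k : ℕ}
    (hf : ∀ i ∈ s, Module.finrank ℂ (LinearMap.range (f i)) ≤ k) :
    Module.finrank ℂ (LinearMap.range (∑ i ∈ s, f i)) ≤ s.card * k := by
  classical
  induction s using Finset.induction_on with
  | empty => rw [Finset.sum_empty, LinearMap.range_zero, finrank_bot]; exact Nat.zero_le _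
  | insert a s ha ih =>
    rw [Finset.sum_insert ha, Finset.card_insert_of_notMem ha, add_mul, one_mul, add_comm (_ * _)]
    refine (Submodule.finrank_mono (LinearMap.range_add_le _ _)).trans ?_
    refine (Submodule.finrank_add_le_finrank_add_finrank _ _).trans ?_
    exact add_le_add (hf a (Finset.mem_insert_self a s))
      (ih fun i hi => hf i (Finset.mem_insert_of_mem hi))

theorem finrank_range_koszulFlattening_partialTensor_le {q r : ℕ}
    {T : homogeneousSubmodule (Fin (d + (q + 1)) × Fin (d + (q + 1))) ℂ (d + (q + 1))}
    (hT : symmetricRank (d + (q + 1)) T = r) :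
    Module.finrank ℂ (LinearMap.range (koszulFlattening (partialTensor d (q + 1) T))) ≤
      r * ((d + (q + 1)) ^ 2 - 1) := by
  obtain ⟨v, hv, hsum⟩ := mem_powerSumLengths_of_symmetricRank_eq hT
  rw [partialTensor_eq_sum hv hsum, map_sum]
  refine (finrank_range_sum_le _ _ fun i _ => finrank_range_koszulFlattening_le _
    fun a => (v i).coeff (Finsupp.single a 1)).trans_eq ?_
  simp [sq]

/-- The inequality given by the Koszul flattening at order `d`. -/
theorem choose_sq_mul_sq_le_of_detForm_mem_zariskiClosure {r : ℕ}
    (h : detForm (d + (p + 2)) ∈ zariskiClosure {T | symmetricRank (d + (p + 2)) T = (r : ℕ∞)}) :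
    (d + (p + 2)).choose (p + 2) ^ 2 * (d + (p + 2)) ^ 2 ≤
      r * ((d + (p + 2)) ^ 2 - 1) + (d + (p + 2)).choose (p + 3) ^ 2 := by
  have h1 := finrank_range_le_of_mem_zariskiClosure
    (koszulFlattening ∘ₗ partialTensor d (p + 2)) (r * ((d + (p + 2)) ^ 2 - 1))
    (fun T hT => finrank_range_koszulFlattening_partialTensor_le hT) h
  rw [LinearMap.comp_apply, partialTensor_detForm] at h1
  exact le_finrank_range_koszulFlattening_minorTensor.trans (Nat.add_le_add_right h1 _)

theorem coe_le_iInf_natCast {A : Set ℕ} {x : ℝ} (h : ∀ r ∈ A, x ≤ r) :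
    (x : EReal) ≤ ((⨅ r ∈ A, (r : ℕ∞) : ℕ∞) : EReal) := by
  -- Over the empty set the infimum is `⊤`, so attainability of the border rank is not needed.
  rcases A.eq_empty_or_nonempty with rfl | hA
  · simp
  · rw [← ENat.natCast_sInf hA]
    exact (EReal.coe_le_coe_iff.2 (h _ (Nat.sInf_mem hA))).trans_eq rfl

end DetBorderRank

end

/-! ### Numerical conclusion. -/

theorem mainTheorem2 (n : ℕ) (hn : 3 ≤ n) :
    (Even n →
      (((1 + 4 / (((n : ℝ) - 1) * ((n : ℝ) + 2) ^ 2)) * (n.choose (n / 2) : ℝ) ^ 2 : ℝ) : EReal) ≤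
        ((DetBorderRank.symmetricBorderRank n (DetBorderRank.detForm n) : ℕ∞) : EReal)) ∧
    (Odd n →
      (((1 + 8 / (((n : ℝ) - 1) * ((n : ℝ) + 3) ^ 2)) * (n.choose ((n - 1) / 2) : ℝ) ^ 2 : ℝ) :
          EReal) ≤
        ((DetBorderRank.symmetricBorderRank n (DetBorderRank.detForm n) : ℕ∞) : EReal)) := by
  have key (d p r : ℕ) (hnd : n = d + (p + 2))
      (hr : DetBorderRank.detForm n ∈ DetBorderRank.zariskiClosure
        {T | DetBorderRank.symmetricRank n T = (r : ℕ∞)}) :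
      ((n.choose (p + 2) : ℝ)) ^ 2 * n ^ 2 ≤ r * (n ^ 2 - 1) + (n.choose (p + 3) : ℝ) ^ 2 ∧
        (n.choose (p + 3) : ℝ) * (p + 3) = n.choose (p + 2) * d := by
    constructor
    · have h : n.choose (p + 2) ^ 2 * n ^ 2 ≤ r * (n ^ 2 - 1) + n.choose (p + 3) ^ 2 := by
        subst hnd
        exact DetBorderRank.choose_sq_mul_sq_le_of_detForm_mem_zariskiClosure hr
      have h1 : 1 ≤ n ^ 2 := Nat.one_le_pow _ _ (by omega)
      have h2 : ((n.choose (p + 2) ^ 2 * n ^ 2 : ℕ) : ℝ) ≤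
          ((r * (n ^ 2 - 1) + n.choose (p + 3) ^ 2 : ℕ) : ℝ) := by exact_mod_cast h
      push_cast [Nat.cast_sub h1] at h2
      exact h2
    · have h := Nat.choose_succ_right_eq n (p + 2)
      rw [show n - (p + 2) = d by omega] at h
      exact_mod_cast h
  constructor
  · rintro ⟨k, rfl⟩
    obtain ⟨p, rfl⟩ : ∃ p, k = p + 2 := ⟨k - 2, by omega⟩
    refine DetBorderRank.coe_le_iInf_natCast fun r hr => ?_
    obtain ⟨h1, h2⟩ := key (p + 2) p r rfl hr
    rw [show (p + 2 + (p + 2)) / 2 = p + 2 by omega]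
    rw [← eq_div_iff (by positivity)] at h2
    rw [h2] at h1
    generalize ((p + 2 + (p + 2)).choose (p + 2) : ℝ) = a at *
    push_cast at *
    have hp : (0 : ℝ) ≤ p := by positivity
    have hpos : (0 : ℝ) < ((p + 2 + (p + 2) : ℝ)) ^ 2 - 1 := by nlinarith
    refine le_of_mul_le_mul_right ?_ hpos
    refine le_trans (le_of_eq ?_) (sub_le_iff_le_add.2 h1)
    have h3 : 2 * (p : ℝ) + 3 ≠ 0 := by linarith
    rw [show (p : ℝ) + 2 + (p + 2) - 1 = 2 * p + 3 by ring]
    have h4 : (p : ℝ) + 2 + (p + 2) + 2 ≠ 0 := by linarith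
    have h5 : (p : ℝ) + 3 ≠ 0 := by linarith
    field_simp
    ring
  · rintro ⟨k, rfl⟩
    obtain ⟨p, rfl⟩ : ∃ p, k = p + 1 := ⟨k - 1, by omega⟩
    refine DetBorderRank.coe_le_iInf_natCast fun r hr => ?_
    -- Here `q = (n+1)/2`; with `q = (n-1)/2` the binomials `C(n,q)` and `C(n,q+1)` coincide and
    -- nothing is gained.
    obtain ⟨h1, h2⟩ := key (p + 1) p r (by omega) hr
    rw [show (2 * (p + 1) + 1 - 1) / 2 = p + 1 by omega,
      Nat.choose_symm_of_eq_add (show 2 * (p + 1) + 1 = (p + 1) + (p + 2) by omega)]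
    rw [← eq_div_iff (by positivity)] at h2
    rw [h2] at h1
    generalize ((2 * (p + 1) + 1).choose (p + 2) : ℝ) = a at *
    push_cast at *
    have hp : (0 : ℝ) ≤ p := by positivity
    have hpos : (0 : ℝ) < ((2 * (p + 1) + 1 : ℝ)) ^ 2 - 1 := by nlinarith
    refine le_of_mul_le_mul_right ?_ hpos
    refine le_trans (le_of_eq ?_) (sub_le_iff_le_add.2 h1)
    have h3 : 2 * ((p : ℝ) + 1) + 1 - 1 ≠ 0 := by linarith
    have h4 : 2 * ((p : ℝ) + 1) + 1 + 3 ≠ 0 := by linarith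
    have h5 : (p : ℝ) + 3 ≠ 0 := by linarith
    field_simp
    ring
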